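/- An affine deformation of 3-space is a pair $(A,a)$ with $A\in GL_3$ and $a$ a 3-vector; its essential matrix is $[a]_\times A$, where $[a]_\times$ is the matrix of $w\mapsto a\times w$. Write $\equiv$ for equality of matrices up to a nonzero scalar. Let $(A,a)$ be the deformation between a first and a second image and $(B,b)$ the deformation between the second and a third image, with no relation assumed between them. Their three essential matrices are $E_{12}\equiv[a]_\times A$, $E_{23}\equiv[b]_\times B$, $E_{13}\equiv[Ba+b]_\times BA$; assume that each of them has rank $2$ (equivalently $a$, $b$ and $Ba+b$ are nonzero). Let $(A_0,a_0)$, $(B_0,b_0)$, $(C_0,c_0)$ be any decompositions of these matrices, that is $E_{12}\equiv[a_0]_\times A_0$, $E_{23}\equiv[b_0]_\times B_0$, $E_{13}\equiv[c_0]_\times C_0$. Let $X\subset\mathbb A^{15}_{\mathbb C}$ be the closed subvariety, in the unknowns $\alpha,\beta,\gamma,x,y,z\in\mathbb C$ and $v_1,v_2,v_3\in\mathbb C^3$, defined by the 15 equations $$\alpha(B_0+b_0v_2^t)a_0+\beta^2b_0-\beta\gamma c_0=0,\qquad \gamma(B_0+b_0v_2^t)(A_0+a_0v_1^t)-\alpha\beta(C_0+c_0v_3^t)=0,$$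 $$\alpha x-1=\beta y-1=\gamma z-1=0.$$ 1. For all such complex (in particular, all real) deformations and all such decompositions, $\dim X\ge 3$. 2. For generic deformations $\dim X=3$: there is a nonzero polynomial $P$ with real coefficients in the 24 entries of $(A,a,B,b)$ such that, whenever $P(A,a,B,b)\neq0$, the matrices $A,B$ are invertible, the three essential matrices have rank $2$, and $\dim X=3$ for all decompositions. 3. Consequently the deformations cannot be recovered from the three images: for all real deformations as above there are infinitely many pairs of real invertible affine deformations with the same three essential matrices up to nonzero scalars. -/

import Mathlib

open Matrix

namespace AffineSfM

/-- A pair `(A, a)` of a `3 × 3` matrix and a vector: the affine map `P ↦ A P + a` of 3-space.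
Invertibility (`det A ≠ 0`) is required separately, through `Deformation.Invertible`. -/
@[ext]
structure Deformation (K : Type*) where
  linear : Matrix (Fin 3) (Fin 3) K
  translation : Fin 3 → K

/-- The matrix `[t]ₓ` of the map `w ↦ t × w` in the standard basis. -/
def crossMatrix {K : Type*} [Field K] (t : Fin 3 → K) : Matrix (Fin 3) (Fin 3) K :=
  !![0, -t 2, t 1; t 2, 0, -t 0; -t 1, t 0, 0]

theorem crossMatrix_mulVec {K : Type*} [Field K] (t w : Fin 3 → K) :
    crossMatrix t *ᵥ w = crossProduct t w := by
  ext i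
  fin_cases i <;> simp [crossMatrix, cross_apply, Matrix.mulVec, dotProduct, Fin.sum_univ_three] <;>
    ring

namespace Deformation

/-- `A` is an invertible matrix. -/
def Invertible {K : Type*} [Field K] (D : Deformation K) : Prop :=
  D.linear.det ≠ 0

/-- `D₁` followed by `D₂`: `(B, b) ∘ (A, a) = (B A, B a + b)`. -/
def andThen {K : Type*} [Field K] (D₁ D₂ : Deformation K) : Deformation K where
  linear := D₂.linear * D₁.linear
  translation := D₂.linear *ᵥ D₁.translation + D₂.translation

/-- The essential matrix `[a]ₓ A`, meaningful up to a nonzero scalar. -/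
def essential {K : Type*} [Field K] (D : Deformation K) : Matrix (Fin 3) (Fin 3) K :=
  crossMatrix D.translation * D.linear

/-- Index set of the 12 coordinates of a deformation. -/
abbrev Coord : Type := (Fin 3 × Fin 3) ⊕ Fin 3

/-- The 12 coordinates of a deformation: the entries of `A` and of `a`. -/
def coord {K : Type*} (D : Deformation K) : Coord → K :=
  Sum.elim (fun ij => D.linear ij.1 ij.2) D.translation

end Deformation

/-- Equality of matrices modulo multiplication by a nonzero scalar. -/
def EqUpToScale {K : Type*} [Field K] (E F : Matrix (Fin 3) (Fin 3) K) : Prop :=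
  ∃ k : K, k ≠ 0 ∧ E = k • F

/-- Both deformations are invertible, and the three essential matrices
`E₁₂ = [a]ₓ A`, `E₂₃ = [b]ₓ B`, `E₁₃ = [B a + b]ₓ B A` are genuine, that is of rank 2. -/
def Admissible {K : Type*} [Field K] (D₁ D₂ : Deformation K) : Prop :=
  D₁.Invertible ∧ D₂.Invertible ∧
    D₁.essential.rank = 2 ∧ D₂.essential.rank = 2 ∧ (D₁.andThen D₂).essential.rank = 2

/-- `(A₀, a₀)`, `(B₀, b₀)`, `(C₀, c₀)` are decompositions `[a₀]ₓ A₀`, `[b₀]ₓ B₀`, `[c₀]ₓ C₀` of the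
three essential matrices (each known only up to a nonzero scalar) of the three images
related by `D₁ = (A, a)` and `D₂ = (B, b)`. -/
def Decomposes {K : Type*} [Field K] (D₁ D₂ R₁₂ R₂₃ R₁₃ : Deformation K) : Prop :=
  EqUpToScale R₁₂.essential D₁.essential ∧
    EqUpToScale R₂₃.essential D₂.essential ∧
    EqUpToScale R₁₃.essential (D₁.andThen D₂).essential

/-- The pairs of invertible deformations that have the same three essential matrices,
up to nonzero scalars, as the pair `D₁`, `D₂`. -/
def indistinguishable {K : Type*} [Field K] (D₁ D₂ : Deformation K) :
    Set (Deformation K × Deformation K) :=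
  {p | p.1.Invertible ∧ p.2.Invertible ∧ Decomposes D₁ D₂ p.1 p.2 (p.1.andThen p.2)}

/-- The 15 unknowns `α, β, γ, x, y, z, v₁, v₂, v₃`. -/
inductive Unknown : Type
  | α | β | γ | x | y | z
  | v₁ (i : Fin 3) | v₂ (i : Fin 3) | v₃ (i : Fin 3)

/-- The ring of polynomial functions on affine 15-space. -/
abbrev PolyRing (K : Type*) [Field K] : Type _ := MvPolynomial Unknown K

section System

variable {K : Type*} [Field K]

/-- A vector of constants, seen in the polynomial ring. -/
noncomputable def constVec (w : Fin 3 → K) : Fin 3 → PolyRing K := fun i => MvPolynomial.C (w i)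

/-- The matrix `A₀ + a₀ vᵗ` where `v` is a vector of unknowns. -/
noncomputable def shifted (R : Deformation K) (v : Fin 3 → Unknown) : Matrix (Fin 3) (Fin 3) (PolyRing K) :=
  R.linear.map MvPolynomial.C +
    vecMulVec (constVec R.translation) (fun i => MvPolynomial.X (v i))

open MvPolynomial in
/-- `α (B₀ + b₀ v₂ᵗ) a₀ + β² b₀ - β γ c₀`. -/
noncomputable def vectorEquation (R₁₂ R₂₃ R₁₃ : Deformation K) : Fin 3 → PolyRing K :=
  (X Unknown.α : PolyRing K) • (shifted R₂₃ Unknown.v₂ *ᵥ constVec R₁₂.translation)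
    + ((X Unknown.β : PolyRing K) ^ 2) • constVec R₂₃.translation
    - ((X Unknown.β : PolyRing K) * X Unknown.γ) • constVec R₁₃.translation

open MvPolynomial in
/-- `γ (B₀ + b₀ v₂ᵗ) (A₀ + a₀ v₁ᵗ) - α β (C₀ + c₀ v₃ᵗ)`. -/
noncomputable def matrixEquation (R₁₂ R₂₃ R₁₃ : Deformation K) : Matrix (Fin 3) (Fin 3) (PolyRing K) :=
  (X Unknown.γ : PolyRing K) • (shifted R₂₃ Unknown.v₂ * shifted R₁₂ Unknown.v₁)
    - ((X Unknown.α : PolyRing K) * X Unknown.β) • shifted R₁₃ Unknown.v₃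

open MvPolynomial in
/-- The ideal generated by the 15 equations: the 3 entries of `vectorEquation`, the 9 entries of
`matrixEquation`, and the localizations `α x - 1`, `β y - 1`, `γ z - 1`. -/
noncomputable def systemIdeal (R₁₂ R₂₃ R₁₃ : Deformation K) : Ideal (PolyRing K) :=
  Ideal.span
    (Set.range (vectorEquation R₁₂ R₂₃ R₁₃) ∪
      {p | ∃ i j, p = matrixEquation R₁₂ R₂₃ R₁₃ i j} ∪
      {X Unknown.α * X Unknown.x - 1, X Unknown.β * X Unknown.y - 1,
        X Unknown.γ * X Unknown.z - 1})

/-- The dimension of the closed subvariety `X` of affine 15-space defined by the 15 equations: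
the Krull dimension of its coordinate ring. (It is `⊥` if `X` is empty, and it does not change if
the ideal is replaced by its radical.) -/
noncomputable def dimX (R₁₂ R₂₃ R₁₃ : Deformation K) : WithBot ℕ∞ :=
  ringKrullDim (PolyRing K ⧸ systemIdeal R₁₂ R₂₃ R₁₃)

end System

end AffineSfM

/-! The kernel of `[a]ₓ` is the line of `a`, so an essential matrix determines its decomposition up
to scalars and a shear: `a₀ = l a`, `A₀ = k A + a uᵗ` (`Deformation.exists_of_eqUpToScale`).
Rescaling `α, β, γ` and changing each `vᵢ` affinely therefore reduces any decompositions to `(A,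
a)`, `(B, b)` and their composition (`nonempty_normalization`, `Normalization.isSolution_iff`).

The reduced system has an explicit family of solutions parametrized by row vectors `u` with `f = 1 +
u · a` invertible: `α = γ = f`, `β = 1`, `v₁ = v₃ = u A`, `v₂ = u / f` (`isSolution_compose`). The
parameter `u = v₁ A⁻¹` can be read off from the solution, so this family has dimension 3 and bounds
the dimension from below.

If `B a` and `b` are independent, contracting the equations with covectors dual to these two vectors
shows that every solution belongs to the family up to a sign `β = ±1` (`IsSolution.eq_of_dual`). The
coordinate ring is then integral over `K[u]` localized at `f`, whence the upper bound.

Requiring `u · a = 0` and `u · B⁻¹ b = 0` leaves at least a line of parameters `u`, and these shear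
the deformations themselves, keeping them invertible and their composition compatible. This needs no
root extraction, so it works over the reals. -/

namespace AffineSfM

/-! ### Essential matrices and their decompositions -/

section EssentialMatrix

variable {K : Type*} [Field K]

theorem exists_eq_smul_of_crossMatrix_mulVec_eq_zero {a w : Fin 3 → K} (ha : a ≠ 0)
    (h : crossMatrix a *ᵥ w = 0) : ∃ c : K, w = c • a := by
  have e0 := congrFun h 0
  have e1 := congrFun h 1
  have e2 := congrFun h 2
  simp [crossMatrix, Matrix.mulVec, dotProduct, Fin.sum_univ_three] at e0 e1 e2
  obtain ⟨i, hi⟩ := Function.ne_iff.mp ha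
  simp only [Pi.zero_apply] at hi
  refine ⟨w i / a i, ?_⟩
  ext j
  simp only [Pi.smul_apply, smul_eq_mul]
  rw [div_mul_eq_mul_div, eq_div_iff hi]
  fin_cases i <;> fin_cases j <;> simp <;> grind

theorem crossMatrix_zero : crossMatrix (0 : Fin 3 → K) = 0 := by
  ext i j
  fin_cases i <;> fin_cases j <;> simp [crossMatrix]

theorem crossMatrix_smul (c : K) (a : Fin 3 → K) : crossMatrix (c • a) = c • crossMatrix a := by
  ext i j
  fin_cases i <;> fin_cases j <;> simp [crossMatrix]

theorem crossMatrix_mulVec_self (a : Fin 3 → K) : crossMatrix a *ᵥ a = 0 := by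
  rw [crossMatrix_mulVec, cross_self]

theorem crossMatrix_vecMul (a w : Fin 3 → K) : w ᵥ* crossMatrix a = crossMatrix w *ᵥ a := by
  ext i
  fin_cases i <;>
    simp [crossMatrix, Matrix.mulVec, Matrix.vecMul, dotProduct, Fin.sum_univ_three] <;> ring

theorem crossMatrix_mul_vecMulVec (a v : Fin 3 → K) : crossMatrix a * vecMulVec a v = 0 := by
  rw [mul_vecMulVec, crossMatrix_mulVec_self, zero_vecMulVec]

theorem rank_crossMatrix {a : Fin 3 → K} (ha : a ≠ 0) : (crossMatrix a).rank = 2 := by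
  have hker : Module.finrank K (LinearMap.ker (crossMatrix a).mulVecLin) = 1 := by
    have : LinearMap.ker (crossMatrix a).mulVecLin = K ∙ a := by
      ext w
      rw [LinearMap.mem_ker, mulVecLin_apply, Submodule.mem_span_singleton]
      constructor
      · intro h
        obtain ⟨c, hc⟩ := exists_eq_smul_of_crossMatrix_mulVec_eq_zero ha h
        exact ⟨c, hc.symm⟩
      · rintro ⟨c, rfl⟩
        rw [mulVec_smul, crossMatrix_mulVec_self, smul_zero]
    rw [this, finrank_span_singleton ha]
  have := (crossMatrix a).mulVecLin.finrank_range_add_finrank_ker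
  rw [hker, Module.finrank_fin_fun] at this
  unfold Matrix.rank
  omega

theorem Deformation.rank_essential {D : Deformation K} (hD : D.Invertible)
    (ha : D.translation ≠ 0) : D.essential.rank = 2 := by
  rw [Deformation.essential, rank_mul_eq_left_of_isUnit_det _ _ (isUnit_iff_ne_zero.mpr hD),
    rank_crossMatrix ha]

theorem Deformation.translation_ne_zero {D : Deformation K} (h : D.essential.rank = 2) :
    D.translation ≠ 0 := by
  intro h0
  rw [Deformation.essential, h0, crossMatrix_zero, zero_mul, rank_zero] at h
  omega

/-- Two decompositions of an essential matrix differ by scalars and by a shear along the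
translation. -/
theorem Deformation.exists_of_eqUpToScale {R D : Deformation K} (hD : D.Invertible)
    (ha : D.translation ≠ 0) (h : EqUpToScale R.essential D.essential) :
    ∃ (k l : K) (u : Fin 3 → K), k ≠ 0 ∧ l ≠ 0 ∧ R.translation = l • D.translation ∧
      R.linear = k • D.linear + vecMulVec D.translation u := by
  obtain ⟨m, hm, h⟩ := h
  unfold Deformation.essential at h
  have hunit : IsUnit D.linear.det := isUnit_iff_ne_zero.mpr hD
  -- `R.translation` annihilates its own essential matrix from the left. Cancelling the invertible
  -- `D.linear` puts it in the left kernel of `[a]ₓ`, which is the line of `a`.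
  have hR : R.translation ᵥ* crossMatrix D.translation = 0 := by
    have h1 : R.translation ᵥ* (crossMatrix R.translation * R.linear) = 0 := by
      rw [← vecMul_vecMul, crossMatrix_vecMul, crossMatrix_mulVec_self, zero_vecMul]
    rw [h, vecMul_smul, ← vecMul_vecMul] at h1
    have h2 := (smul_eq_zero.mp h1).resolve_left hm
    have h3 := congrArg (fun w => w ᵥ* D.linear⁻¹) h2
    simpa [vecMul_vecMul, mul_assoc, mul_nonsing_inv _ hunit] using h3
  obtain ⟨l, hl⟩ := exists_eq_smul_of_crossMatrix_mulVec_eq_zero ha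
    (w := R.translation) (by
      rw [crossMatrix_vecMul] at hR
      rw [crossMatrix_mulVec] at hR ⊢
      rw [← cross_anticomm, hR, neg_zero])
  have hl0 : l ≠ 0 := by
    rintro rfl
    rw [hl, zero_smul, crossMatrix_zero, zero_mul] at h
    have h2 := (smul_eq_zero.mp h.symm).resolve_left hm
    have := rank_essential hD ha
    rw [Deformation.essential, h2, rank_zero] at this
    omega
  -- Since `l [a]ₓ R.linear = m [a]ₓ D.linear`, the columns of `R.linear - (m / l) D.linear` lie in
  -- the kernel of `[a]ₓ`.
  have hcol : ∀ j, ∃ c : K, (fun i => (R.linear - (m / l) • D.linear) i j) = c • D.translation := by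
    intro j
    apply exists_eq_smul_of_crossMatrix_mulVec_eq_zero ha
    have : crossMatrix D.translation * (R.linear - (m / l) • D.linear) = 0 := by
      rw [hl, crossMatrix_smul, Matrix.smul_mul] at h
      rw [mul_sub, Matrix.mul_smul, sub_eq_zero, div_eq_inv_mul, ← smul_smul, ← h, smul_smul,
        inv_mul_cancel₀ hl0, one_smul]
    ext i
    exact congrFun (congrFun this i) j
  choose u hu using hcol
  refine ⟨m / l, l, u, div_ne_zero hm hl0, hl0, hl, ?_⟩
  ext i j
  have := congrFun (hu j) i
  simp only [Matrix.sub_apply, Matrix.smul_apply, Pi.smul_apply, smul_eq_mul] at this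
  simp only [Matrix.add_apply, Matrix.smul_apply, vecMulVec_apply, smul_eq_mul]
  linear_combination this

end EssentialMatrix

end AffineSfM

namespace AffineSfM

/-! ### Shears that preserve the three essential matrices -/

section Ambiguity

variable {K : Type*} [Field K]

theorem det_one_add_vecMulVec {n R : Type*} [Fintype n] [DecidableEq n] [CommRing R]
    (u v : n → R) : (1 + vecMulVec u v).det = 1 + v ⬝ᵥ u := by
  rw [vecMulVec_eq Unit, det_one_add_replicateCol_mul_replicateRow]

theorem exists_ne_zero_dotProduct_eq_zero (a b : Fin 3 → K) :
    ∃ u : Fin 3 → K, u ≠ 0 ∧ u ⬝ᵥ a = 0 ∧ u ⬝ᵥ b = 0 := by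
  -- The zero row makes a singular square matrix, whose kernel is orthogonal to `a` and `b`.
  have hdet : (Matrix.of ![a, b, 0]).det = 0 :=
    det_eq_zero_of_row_eq_zero 2 (fun j => by simp)
  obtain ⟨u, hu, h⟩ := exists_mulVec_eq_zero_iff.mpr hdet
  refine ⟨u, hu, ?_, ?_⟩
  · rw [dotProduct_comm]
    exact congrFun h 0
  · rw [dotProduct_comm]
    exact congrFun h 1

/-- The shears along the translation vectors that leave the three essential matrices unchanged. -/
theorem shear_mem_indistinguishable {D₁ D₂ : Deformation K} (h₁ : D₁.Invertible)
    (h₂ : D₂.Invertible) {u : Fin 3 → K} (hu₁ : u ⬝ᵥ D₁.translation = 0)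
    (hu₂ : u ⬝ᵥ (D₂.linear⁻¹ *ᵥ D₂.translation) = 0) :
    ((⟨D₁.linear + vecMulVec D₁.translation (u ᵥ* D₁.linear), D₁.translation⟩,
      ⟨D₂.linear + vecMulVec D₂.translation u, D₂.translation⟩) :
        Deformation K × Deformation K) ∈ indistinguishable D₁ D₂ := by
  -- These factorizations give the determinants: the extra factors are `1 + u · a` and `1 + u · B⁻¹
  -- b`, both equal to 1.
  have e₁ : D₁.linear + vecMulVec D₁.translation (u ᵥ* D₁.linear)
      = (1 + vecMulVec D₁.translation u) * D₁.linear := by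
    rw [add_mul, one_mul, vecMulVec_mul]
  have e₂ : D₂.linear + vecMulVec D₂.translation u
      = D₂.linear * (1 + vecMulVec (D₂.linear⁻¹ *ᵥ D₂.translation) u) := by
    rw [mul_add, mul_one, mul_vecMulVec, mulVec_mulVec,
      mul_nonsing_inv _ (isUnit_iff_ne_zero.mpr h₂), one_mulVec]
  refine ⟨?_, ?_, ⟨1, one_ne_zero, ?_⟩, ⟨1, one_ne_zero, ?_⟩, ⟨1, one_ne_zero, ?_⟩⟩
  · change det _ ≠ 0
    rw [e₁, det_mul, det_one_add_vecMulVec, hu₁, add_zero, one_mul]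
    exact h₁
  · change det _ ≠ 0
    rw [e₂, det_mul, det_one_add_vecMulVec, hu₂, add_zero, mul_one]
    exact h₂
  · simp only [Deformation.essential, mul_add, crossMatrix_mul_vecMulVec, add_zero, one_smul]
  · simp only [Deformation.essential, mul_add, crossMatrix_mul_vecMulVec, add_zero, one_smul]
  · have ht : (D₂.linear + vecMulVec D₂.translation u) *ᵥ D₁.translation + D₂.translation
        = D₂.linear *ᵥ D₁.translation + D₂.translation := by
      rw [add_mulVec, vecMulVec_mulVec, hu₁]
      simp
    have hl : (D₂.linear + vecMulVec D₂.translation u)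
          * (D₁.linear + vecMulVec D₁.translation (u ᵥ* D₁.linear))
        = D₂.linear * D₁.linear
          + vecMulVec (D₂.linear *ᵥ D₁.translation + D₂.translation) (u ᵥ* D₁.linear) := by
      rw [add_mul, mul_add, mul_add, mul_vecMulVec, vecMulVec_mul, vecMulVec_mul_vecMulVec, hu₁,
        add_vecMulVec]
      simp [add_assoc]
    simp only [Deformation.essential, Deformation.andThen]
    rw [ht, hl, mul_add, crossMatrix_mul_vecMulVec, add_zero, one_smul]

theorem infinite_indistinguishable [Infinite K] {D₁ D₂ : Deformation K} (h : Admissible D₁ D₂) :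
    (indistinguishable D₁ D₂).Infinite := by
  obtain ⟨h₁, h₂, -, hr, -⟩ := h
  obtain ⟨u, hu, hu₁, hu₂⟩ := exists_ne_zero_dotProduct_eq_zero D₁.translation
    (D₂.linear⁻¹ *ᵥ D₂.translation)
  have hmem : ∀ t : K, _ := fun t => shear_mem_indistinguishable h₁ h₂ (u := t • u)
    (by rw [smul_dotProduct, hu₁, smul_zero]) (by rw [smul_dotProduct, hu₂, smul_zero])
  refine Set.infinite_of_injective_forall_mem (fun s t hst => ?_) hmem
  have hst' := congrArg Deformation.linear (Prod.mk.inj hst).2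
  simp only [add_right_inj, vecMulVec_smul] at hst'
  have hne : vecMulVec D₂.translation u ≠ 0 :=
    vecMulVec_ne_zero (Deformation.translation_ne_zero hr) hu
  exact smul_left_injective K hne hst'

end Ambiguity

/-! ### The system of equations over a commutative ring -/

section Solutions

variable {S : Type*} [CommRing S]

/-- The matrix `A + a vᵗ`. -/
def shear (D : Deformation S) (v : Fin 3 → S) : Matrix (Fin 3) (Fin 3) S :=
  D.linear + vecMulVec D.translation v

/-- The composition `(B A, B a + b)` over a commutative ring. -/
def compose (D₁ D₂ : Deformation S) : Deformation S :=
  ⟨D₂.linear * D₁.linear, D₂.linear *ᵥ D₁.translation + D₂.translation⟩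

/-- The vector equation and the matrix equation, for unknowns in a commutative ring. -/
structure IsSolution (R₁₂ R₂₃ R₁₃ : Deformation S) (α β γ : S) (v₁ v₂ v₃ : Fin 3 → S) :
    Prop where
  vector_eq : α • (shear R₂₃ v₂ *ᵥ R₁₂.translation) + β ^ 2 • R₂₃.translation
    = (β * γ) • R₁₃.translation
  matrix_eq : γ • (shear R₂₃ v₂ * shear R₁₂ v₁) = (α * β) • shear R₁₃ v₃

/-- The relations `hα`, `hγ`, `hαβγ` are exactly what makes the terms of the vector equation scale
by the common factor `t ^ 2 * l₂` and those of the matrix equation by `r * k₁ * k₂`; units can be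
cancelled. -/
theorem isSolution_rescale {D₁₂ D₂₃ D₁₃ R₁₂ R₂₃ R₁₃ : Deformation S}
    {v₁ v₂ v₃ w₁ w₂ w₃ : Fin 3 → S} {k₁ k₂ k₃ l₁ l₂ l₃ r s t : S}
    (ht₁ : R₁₂.translation = l₁ • D₁₂.translation) (ht₂ : R₂₃.translation = l₂ • D₂₃.translation)
    (ht₃ : R₁₃.translation = l₃ • D₁₃.translation)
    (hs₁ : shear R₁₂ v₁ = k₁ • shear D₁₂ w₁) (hs₂ : shear R₂₃ v₂ = k₂ • shear D₂₃ w₂)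
    (hs₃ : shear R₁₃ v₃ = k₃ • shear D₁₃ w₃)
    (hα : s * k₂ * l₁ = t ^ 2 * l₂) (hγ : t * r * l₃ = t ^ 2 * l₂) (hαβγ : s * t * k₃ = r * k₁ * k₂)
    (hu : IsUnit (t ^ 2 * l₂)) (hu' : IsUnit (r * k₁ * k₂)) (α β γ : S) :
    IsSolution R₁₂ R₂₃ R₁₃ (s * α) (t * β) (r * γ) v₁ v₂ v₃ ↔
      IsSolution D₁₂ D₂₃ D₁₃ α β γ w₁ w₂ w₃ := by
  have hvec : (s * α) • (shear R₂₃ v₂ *ᵥ R₁₂.translation) + (t * β) ^ 2 • R₂₃.translation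
      = (t ^ 2 * l₂) • (α • (shear D₂₃ w₂ *ᵥ D₁₂.translation) + β ^ 2 • D₂₃.translation) := by
    rw [hs₂, ht₁, ht₂, smul_mulVec, mulVec_smul, smul_add]
    simp only [smul_smul]
    congr 2
    · linear_combination α * hα
    · ring
  have hvec' : (t * β * (r * γ)) • R₁₃.translation
      = (t ^ 2 * l₂) • ((β * γ) • D₁₃.translation) := by
    rw [ht₃, smul_smul, smul_smul]
    congr 1
    linear_combination β * γ * hγ
  have hmat : (r * γ) • (shear R₂₃ v₂ * shear R₁₂ v₁)
      = (r * k₁ * k₂) • (γ • (shear D₂₃ w₂ * shear D₁₂ w₁)) := by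
    rw [hs₂, hs₁, Matrix.smul_mul, Matrix.mul_smul]
    simp only [smul_smul]
    congr 1
    ring
  have hmat' : (s * α * (t * β)) • shear R₁₃ v₃
      = (r * k₁ * k₂) • ((α * β) • shear D₁₃ w₃) := by
    rw [hs₃]
    simp only [smul_smul]
    congr 1
    linear_combination α * β * hαβγ
  constructor
  · rintro ⟨h, h'⟩
    rw [hvec, hvec'] at h
    rw [hmat, hmat'] at h'
    exact ⟨hu.smul_left_cancel.mp h, hu'.smul_left_cancel.mp h'⟩
  · rintro ⟨h, h'⟩
    refine ⟨?_, ?_⟩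
    · rw [hvec, hvec', h]
    · rw [hmat, hmat', h']

/-- A three-parameter family of solutions for a pair of deformations and their composition. -/
theorem isSolution_compose (D₁ D₂ : Deformation S) (u : Fin 3 → S) {f z : S}
    (hf : f = 1 + u ⬝ᵥ D₁.translation) (hz : f * z = 1) :
    IsSolution D₁ D₂ (compose D₁ D₂) f 1 f (u ᵥ* D₁.linear) (z • u) (u ᵥ* D₁.linear) := by
  constructor
  · simp only [shear, compose, add_mulVec, vecMulVec_mulVec, smul_dotProduct]
    ext i
    simp only [Pi.add_apply, Pi.smul_apply, smul_eq_mul, MulOpposite.smul_eq_mul_unop,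
      MulOpposite.unop_op]
    linear_combination D₂.translation i * (u ⬝ᵥ D₁.translation) * hz - D₂.translation i * hf
  · simp only [shear, compose, mul_add, add_mul, mul_vecMulVec, vecMulVec_mul, mul_one,
      vecMulVec_mulVec, smul_dotProduct, smul_vecMul, add_vecMulVec]
    ext i j
    simp only [Matrix.add_apply, Matrix.smul_apply, Pi.smul_apply, smul_eq_mul, vecMulVec_apply,
      MulOpposite.smul_eq_mul_unop, MulOpposite.unop_op]
    linear_combination D₂.translation i * (u ᵥ* D₁.linear) j * (1 + u ⬝ᵥ D₁.translation) * hz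
      - D₂.translation i * (u ᵥ* D₁.linear) j * hf

/-- If `B a` and `b` are linearly independent, every solution lies in the three-parameter family,
up to a sign. -/
theorem IsSolution.eq_of_dual {D₁ D₂ : Deformation S} {α β γ : S} {v₁ v₂ v₃ : Fin 3 → S}
    (h : IsSolution D₁ D₂ (compose D₁ D₂) α β γ v₁ v₂ v₃)
    (hα : IsUnit α) (hβ : IsUnit β) (hγ : IsUnit γ)
    {p q r : Fin 3 → S}
    (hpa : p ⬝ᵥ (D₂.linear *ᵥ D₁.translation) = 1) (hpb : p ⬝ᵥ D₂.translation = 0)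
    (hqa : q ⬝ᵥ (D₂.linear *ᵥ D₁.translation) = 0) (hqb : q ⬝ᵥ D₂.translation = 1)
    (hra : r ⬝ᵥ (D₂.linear *ᵥ D₁.translation) = 0) (hrb : r ⬝ᵥ D₂.translation = 0)
    {j : Fin 3} (hr : IsUnit ((r ᵥ* (D₂.linear * D₁.linear)) j))
    {u : Fin 3 → S} (hu : v₁ = u ᵥ* D₁.linear) (hA : IsUnit D₁.linear.det) :
    β ^ 2 = 1 ∧ α = β * γ ∧ v₃ = v₁ ∧ γ • v₂ = β • u ∧ γ = β * (1 + u ⬝ᵥ D₁.translation) := by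
  obtain ⟨hv, hm⟩ := h
  -- Both equations are contracted on the left with an arbitrary covector `w`, then evaluated at
  -- `p`, `q`, `r`.
  have hv' : ∀ w : Fin 3 → S, α * (w ⬝ᵥ (D₂.linear *ᵥ D₁.translation)
      + (w ⬝ᵥ D₂.translation) * (v₂ ⬝ᵥ D₁.translation)) + β ^ 2 * (w ⬝ᵥ D₂.translation)
      = β * γ * (w ⬝ᵥ (D₂.linear *ᵥ D₁.translation) + w ⬝ᵥ D₂.translation) := by
    intro w
    have := congrArg (fun x => w ⬝ᵥ x) hv
    simp [shear, compose, add_mulVec, vecMulVec_mulVec, dotProduct_add, dotProduct_smul] at this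
    linear_combination this
  have hm' : ∀ w : Fin 3 → S, γ • (w ᵥ* (D₂.linear * D₁.linear)
      + (w ⬝ᵥ D₂.translation) • (v₂ ᵥ* D₁.linear)
      + ((w ⬝ᵥ (D₂.linear *ᵥ D₁.translation)) • v₁
        + ((v₂ ⬝ᵥ D₁.translation) * (w ⬝ᵥ D₂.translation)) • v₁))
      = (α * β) • (w ᵥ* (D₂.linear * D₁.linear)
        + (w ⬝ᵥ (D₂.linear *ᵥ D₁.translation) + w ⬝ᵥ D₂.translation) • v₃) := by
    intro w
    have := congrArg (fun x => w ᵥ* x) hm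
    simpa [shear, compose, mul_add, add_mul, mul_vecMulVec, vecMulVec_mul, vecMul_add,
      vecMulVec_mulVec, vecMul_smul, vecMul_vecMulVec, dotProduct_add, smul_smul,
      mul_assoc] using this
  -- The covector `r` kills all the rank-one terms, leaving only the multiples of `r B A`.
  have hγαβ : γ = α * β := by
    have := congrFun (hm' r) j
    simp only [hra, hrb] at this
    simp only [zero_smul, mul_zero, add_zero, Pi.smul_apply, smul_eq_mul] at this
    exact hr.mul_right_cancel this
  have hαβγ : α = β * γ := by
    have := hv' p
    rw [hpa, hpb] at this
    linear_combination this
  -- Substituting `γ = α β` in `α = β γ` gives `α = α β²`.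
  have hββ : β ^ 2 = 1 := by
    apply hα.mul_left_cancel
    linear_combination (-β) * hγαβ - hαβγ
  have hva : γ * (v₂ ⬝ᵥ D₁.translation) = γ - β := by
    have := hv' q
    rw [hqa, hqb] at this
    apply hβ.mul_left_cancel
    linear_combination this - (v₂ ⬝ᵥ D₁.translation) * hαβγ
  have h31 : v₃ = v₁ := by
    have := hm' p
    rw [hpa, hpb, ← hγαβ] at this
    have := hγ.smul_left_cancel.mp this
    simpa using this.symm
  -- Contraction with `q` gives `v₂ A + (v₂ · a) v₁ = v₁`; multiplying by `γ` and using `hva` turns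
  -- this into `γ v₂ A = β v₁ = β u A`.
  have hvu : γ • v₂ = β • u := by
    have h1 := hm' q
    rw [hqa, hqb, ← hγαβ, h31] at h1
    have h2 := hγ.smul_left_cancel.mp h1
    have h3 : (γ • v₂) ᵥ* D₁.linear = (β • u) ᵥ* D₁.linear := by
      rw [smul_vecMul, smul_vecMul, ← hu]
      ext i
      have h4 := congrFun h2 i
      simp only [Pi.add_apply, Pi.smul_apply, smul_eq_mul] at h4 ⊢
      linear_combination γ * h4 - v₁ i * hva
    have h5 := congrArg (fun x => x ᵥ* D₁.linear⁻¹) h3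
    simpa [vecMul_vecMul, mul_nonsing_inv _ hA] using h5
  refine ⟨hββ, hαβγ, h31, hvu, ?_⟩
  have := congrArg (fun x => x ⬝ᵥ D₁.translation) hvu
  simp only [smul_dotProduct, smul_eq_mul] at this
  linear_combination this - hva

end Solutions

end AffineSfM

namespace AffineSfM

/-! ### Bounds for Krull dimension -/

section Dimension

/-- Restriction to the coordinate subspace where the first `k` coordinates vanish. -/
noncomputable def coordinateSubspaceHom (K : Type*) [Field K] (n : ℕ) (k : Fin (n + 1)) :
    MvPolynomial (Fin n) K →ₐ[K] MvPolynomial (Fin n) K :=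
  MvPolynomial.aeval fun i => if i.castSucc < k then 0 else MvPolynomial.X i

variable {K : Type*} [Field K] {n : ℕ}

theorem coordinateSubspaceHom_X (k : Fin (n + 1)) (i : Fin n) :
    coordinateSubspaceHom K n k (MvPolynomial.X i)
      = if i.castSucc < k then 0 else MvPolynomial.X i :=
  MvPolynomial.aeval_X _ _

theorem coordinateSubspaceHom_comp {k l : Fin (n + 1)} (h : k ≤ l) :
    (coordinateSubspaceHom K n l).comp (coordinateSubspaceHom K n k)
      = coordinateSubspaceHom K n l := by
  ext1 i
  rw [AlgHom.comp_apply, coordinateSubspaceHom_X]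
  split_ifs with hi
  · rw [map_zero, coordinateSubspaceHom_X, if_pos (hi.trans_le h)]
  · rfl

/-- All these subspaces contain the origin, so a polynomial with nonzero constant term lies in none
of the kernels, and the chain of kernels survives localization at it. -/
theorem constantCoeff_coordinateSubspaceHom (k : Fin (n + 1)) (f : MvPolynomial (Fin n) K) :
    MvPolynomial.constantCoeff (coordinateSubspaceHom K n k f)
      = MvPolynomial.constantCoeff f := by
  have : (MvPolynomial.constantCoeff).comp (coordinateSubspaceHom K n k).toRingHom
      = MvPolynomial.constantCoeff := by
    apply MvPolynomial.ringHom_ext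
    · intro r
      simp [coordinateSubspaceHom]
    · intro i
      simp only [RingHom.comp_apply, AlgHom.toRingHom_eq_coe, RingHom.coe_coe,
        coordinateSubspaceHom_X]
      split_ifs <;> simp
  exact RingHom.congr_fun this f

theorem strictMono_ker_coordinateSubspaceHom :
    StrictMono fun k => RingHom.ker (coordinateSubspaceHom K n k) := by
  intro k l hkl
  refine lt_of_le_of_ne ?_ ?_
  · intro f hf
    rw [RingHom.mem_ker] at hf ⊢
    rw [← coordinateSubspaceHom_comp hkl.le, AlgHom.comp_apply, hf, map_zero]
  · intro heq
    have hk : k.val < n := by have := l.isLt; have := Fin.lt_def.mp hkl; omega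
    have hmem : MvPolynomial.X (⟨k, hk⟩ : Fin n) ∈ RingHom.ker (coordinateSubspaceHom K n l) := by
      rw [RingHom.mem_ker, coordinateSubspaceHom_X, if_pos]
      exact hkl
    simp only at heq
    rw [← heq, RingHom.mem_ker, coordinateSubspaceHom_X, if_neg] at hmem
    · exact MvPolynomial.X_ne_zero _ hmem
    · exact lt_irrefl k

/-- A ring through which the localization map of a polynomial ring at a polynomial not vanishing
at the origin factors has at least the dimension of the polynomial ring. -/
theorem le_ringKrullDim_of_comp_eq_algebraMap {f : MvPolynomial (Fin n) K}
    (hf : MvPolynomial.constantCoeff f ≠ 0) {T : Type*} [CommRing T]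
    (i : MvPolynomial (Fin n) K →+* T) (φ : T →+* Localization.Away f)
    (h : φ.comp i = algebraMap _ _) : (n : WithBot ℕ∞) ≤ ringKrullDim T := by
  let P (k : Fin (n + 1)) : Ideal (MvPolynomial (Fin n) K) :=
    RingHom.ker (coordinateSubspaceHom K n k)
  have hP (k) : (P k).IsPrime := RingHom.ker_isPrime _
  have hd (k) : Disjoint (Submonoid.powers f : Set (MvPolynomial (Fin n) K)) (P k) := by
    rw [Ideal.disjoint_powers_iff_notMem _ (hP k).isRadical]
    intro hmem
    apply hf
    rw [← constantCoeff_coordinateSubspaceHom k, RingHom.mem_ker.mp hmem, map_zero]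
  have hQ (k) := IsLocalization.isPrime_of_isPrime_disjoint (Submonoid.powers f)
    (Localization.Away f) (P k) (hP k) (hd k)
  let q (k : Fin (n + 1)) : PrimeSpectrum T := PrimeSpectrum.comap φ ⟨_, hQ k⟩
  -- Pulling back further along `i` recovers `P k`, so the inclusions between the `q k` remain
  -- strict.
  have hq (k) : (q k).asIdeal.comap i = P k := by
    change Ideal.comap i (Ideal.comap φ _) = _
    rw [Ideal.comap_comap, h]
    exact IsLocalization.under_map_of_isPrime_disjoint (Submonoid.powers f)
      (Localization.Away f) (hP k) (hd k)
  have hmono : StrictMono q := by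
    intro k l hkl
    have hlt : P k < P l := strictMono_ker_coordinateSubspaceHom hkl
    refine lt_of_le_of_ne ?_ ?_
    · exact Ideal.comap_mono (Ideal.map_mono hlt.le)
    · intro heq
      exact hlt.ne (by rw [← hq k, ← hq l, heq])
  exact Order.le_krullDim_iff.mpr ⟨LTSeries.mk n q hmono, rfl⟩

/-- Primes in an integral extension satisfy incomparability, and the spectrum of a localization
embeds in that of the ring; so strict chains in `T` map to strict chains in `P`. -/
theorem ringKrullDim_le_of_isIntegral_away {P T : Type*} [CommRing P] [CommRing T] {f : P}
    (g : Localization.Away f →+* T) (hg : g.IsIntegral) : ringKrullDim T ≤ ringKrullDim P := by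
  algebraize [g]
  have h₁ : ringKrullDim T ≤ ringKrullDim (Localization.Away f) :=
    Order.krullDim_le_of_strictMono (PrimeSpectrum.comap (algebraMap (Localization.Away f) T))
      fun p q hpq => Ideal.IsIntegral.comap_lt_comap (I := p.asIdeal) hpq
  refine h₁.trans (Order.krullDim_le_of_strictMono
    (PrimeSpectrum.comap (algebraMap P (Localization.Away f))) ?_)
  exact Monotone.strictMono_of_injective (fun p q hpq => Ideal.comap_mono hpq)
    (PrimeSpectrum.localization_comap_injective _ (Submonoid.powers f))

end Dimension

/-! ### Points of `X` with values in an algebra -/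

section BaseChange

variable {K : Type*} [Field K]

/-- A deformation with coefficients in `K`, over a `K`-algebra. -/
def baseChange (S : Type*) [CommRing S] [Algebra K S] (D : Deformation K) : Deformation S :=
  ⟨D.linear.map (algebraMap K S), fun i => algebraMap K S (D.translation i)⟩

variable {S : Type*} [CommRing S] [Algebra K S]

theorem baseChange_andThen (D₁ D₂ : Deformation K) :
    baseChange S (D₁.andThen D₂) = compose (baseChange S D₁) (baseChange S D₂) := by
  ext i
  · simp only [baseChange, compose, Deformation.andThen, Matrix.map_apply]
    rw [RingHom.map_matrix_mul]
  · simp only [baseChange, compose, Deformation.andThen, Pi.add_apply, map_add]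
    rw [RingHom.map_mulVec]
    rfl

theorem shear_baseChange {R D : Deformation K} {k l : K} {u : Fin 3 → K} {v w : Fin 3 → S}
    (ht : R.translation = l • D.translation)
    (hl : R.linear = k • D.linear + vecMulVec D.translation u)
    (hw : ∀ i, algebraMap K S k * w i = algebraMap K S (u i) + algebraMap K S l * v i) :
    shear (baseChange S R) v = algebraMap K S k • shear (baseChange S D) w := by
  ext i j
  simp only [shear, baseChange, ht, hl, Matrix.add_apply, Matrix.smul_apply, Matrix.map_apply,
    vecMulVec_apply, Pi.smul_apply, smul_eq_mul, map_add, map_mul]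
  linear_combination (-algebraMap K S (D.translation i)) * hw j

theorem translation_baseChange {R D : Deformation K} {l : K}
    (ht : R.translation = l • D.translation) :
    (baseChange S R).translation = algebraMap K S l • (baseChange S D).translation := by
  ext i
  simp [baseChange, ht]

theorem map_C_eq_algebraMap (φ : PolyRing K →ₐ[K] S) (c : K) :
    φ (MvPolynomial.C c) = algebraMap K S c :=
  φ.commutes c

open MvPolynomial in
theorem map_shifted (φ : PolyRing K →ₐ[K] S) (R : Deformation K) (v : Fin 3 → Unknown)
    (i j : Fin 3) : φ (shifted R v i j) = shear (baseChange S R) (fun i => φ (X (v i))) i j := by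
  simp only [shifted, shear, baseChange, constVec, vecMulVec_apply, Matrix.add_apply,
    Matrix.map_apply, map_add, map_mul, map_C_eq_algebraMap]

open MvPolynomial in
theorem map_vectorEquation (φ : PolyRing K →ₐ[K] S) (R₁₂ R₂₃ R₁₃ : Deformation K) (i : Fin 3) :
    φ (vectorEquation R₁₂ R₂₃ R₁₃ i)
      = (φ (X Unknown.α) • (shear (baseChange S R₂₃) (fun i => φ (X (Unknown.v₂ i)))
            *ᵥ (baseChange S R₁₂).translation)
          + φ (X Unknown.β) ^ 2 • (baseChange S R₂₃).translation) i
        - ((φ (X Unknown.β) * φ (X Unknown.γ)) • (baseChange S R₁₃).translation) i := by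
  simp only [vectorEquation, Pi.sub_apply, Pi.add_apply, Pi.smul_apply, smul_eq_mul, map_sub,
    map_add, map_mul, map_pow, mulVec, dotProduct, map_sum, map_shifted]
  simp only [baseChange, constVec, map_C_eq_algebraMap]

open MvPolynomial in
theorem map_matrixEquation (φ : PolyRing K →ₐ[K] S) (R₁₂ R₂₃ R₁₃ : Deformation K)
    (i j : Fin 3) :
    φ (matrixEquation R₁₂ R₂₃ R₁₃ i j)
      = (φ (X Unknown.γ) • (shear (baseChange S R₂₃) (fun i => φ (X (Unknown.v₂ i)))
            * shear (baseChange S R₁₂) (fun i => φ (X (Unknown.v₁ i))))) i j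
        - ((φ (X Unknown.α) * φ (X Unknown.β))
            • shear (baseChange S R₁₃) (fun i => φ (X (Unknown.v₃ i)))) i j := by
  simp only [matrixEquation, Matrix.sub_apply, Matrix.smul_apply, smul_eq_mul, map_sub, map_mul,
    Matrix.mul_apply, map_sum, map_shifted]

open MvPolynomial in
-- Serves in both directions: the explicit family yields a map out of the coordinate ring, and the
-- quotient map yields the universal solution.
theorem systemIdeal_le_ker_iff (φ : PolyRing K →ₐ[K] S) (R₁₂ R₂₃ R₁₃ : Deformation K) :
    systemIdeal R₁₂ R₂₃ R₁₃ ≤ RingHom.ker φ ↔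
      IsSolution (baseChange S R₁₂) (baseChange S R₂₃) (baseChange S R₁₃)
        (φ (X Unknown.α)) (φ (X Unknown.β)) (φ (X Unknown.γ)) (fun i => φ (X (Unknown.v₁ i)))
        (fun i => φ (X (Unknown.v₂ i))) (fun i => φ (X (Unknown.v₃ i))) ∧
      φ (X Unknown.α) * φ (X Unknown.x) = 1 ∧ φ (X Unknown.β) * φ (X Unknown.y) = 1 ∧
      φ (X Unknown.γ) * φ (X Unknown.z) = 1 := by
  rw [systemIdeal, Ideal.span_le, Set.union_subset_iff, Set.union_subset_iff, Set.range_subset_iff]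
  have h₃ : ({X Unknown.α * X Unknown.x - 1, X Unknown.β * X Unknown.y - 1,
        X Unknown.γ * X Unknown.z - 1} : Set (PolyRing K)) ⊆ RingHom.ker φ ↔
      φ (X Unknown.α) * φ (X Unknown.x) = 1 ∧ φ (X Unknown.β) * φ (X Unknown.y) = 1 ∧
      φ (X Unknown.γ) * φ (X Unknown.z) = 1 := by
    simp [Set.insert_subset_iff, RingHom.mem_ker, sub_eq_zero]
  rw [h₃]
  refine and_congr_left fun _ => ⟨fun ⟨h₁, h₂⟩ => ⟨?_, ?_⟩, fun h => ⟨fun i => ?_, ?_⟩⟩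
  · ext i
    rw [← sub_eq_zero, ← map_vectorEquation]
    exact h₁ i
  · ext i j
    rw [← sub_eq_zero, ← map_matrixEquation]
    exact h₂ ⟨i, j, rfl⟩
  · change φ _ = 0
    rw [map_vectorEquation, h.vector_eq, sub_self]
  · rintro _ ⟨i, j, rfl⟩
    change φ _ = 0
    rw [map_matrixEquation, h.matrix_eq, sub_self]

end BaseChange

end AffineSfM

namespace AffineSfM

/-! ### Reduction to the original deformations, and the lower bound -/

section Normalization

variable {K : Type*} [Field K]

/-- Scalars and shears that turn decompositions of the three essential matrices into the
deformations themselves and their composition. -/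
structure Normalization (D₁ D₂ R₁₂ R₂₃ R₁₃ : Deformation K) where
  (k₁ k₂ k₃ l₁ l₂ l₃ r s t : K)
  (u₁ u₂ u₃ : Fin 3 → K)
  k₁_ne : k₁ ≠ 0
  k₂_ne : k₂ ≠ 0
  k₃_ne : k₃ ≠ 0
  l₁_ne : l₁ ≠ 0
  l₂_ne : l₂ ≠ 0
  l₃_ne : l₃ ≠ 0
  r_ne : r ≠ 0
  s_ne : s ≠ 0
  t_ne : t ≠ 0
  translation₁ : R₁₂.translation = l₁ • D₁.translation
  translation₂ : R₂₃.translation = l₂ • D₂.translation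
  translation₃ : R₁₃.translation = l₃ • (D₁.andThen D₂).translation
  linear₁ : R₁₂.linear = k₁ • D₁.linear + vecMulVec D₁.translation u₁
  linear₂ : R₂₃.linear = k₂ • D₂.linear + vecMulVec D₂.translation u₂
  linear₃ : R₁₃.linear = k₃ • (D₁.andThen D₂).linear + vecMulVec (D₁.andThen D₂).translation u₃
  rel_α : s * k₂ * l₁ = t ^ 2 * l₂
  rel_γ : t * r * l₃ = t ^ 2 * l₂
  rel_αβγ : s * t * k₃ = r * k₁ * k₂

/-- `rel_γ` and `rel_α` determine `r` and `s` from `t`. The last relation then becomes `t ^ 2 = k₁ *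
k₂ ^ 2 * l₁ / (l₃ * k₃)`, and this square root is why `K` is taken algebraically closed. -/
theorem nonempty_normalization [IsAlgClosed K] {D₁ D₂ R₁₂ R₂₃ R₁₃ : Deformation K}
    (h : Admissible D₁ D₂) (hR : Decomposes D₁ D₂ R₁₂ R₂₃ R₁₃) :
    Nonempty (Normalization D₁ D₂ R₁₂ R₂₃ R₁₃) := by
  obtain ⟨h₁, h₂, r₁, r₂, r₃⟩ := h
  have h₃ : (D₁.andThen D₂).Invertible := by
    change (D₂.linear * D₁.linear).det ≠ 0
    rw [det_mul]
    exact mul_ne_zero h₂ h₁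
  obtain ⟨e₁, e₂, e₃⟩ := hR
  obtain ⟨k₁, l₁, u₁, hk₁, hl₁, t₁, m₁⟩ :=
    Deformation.exists_of_eqUpToScale h₁ (Deformation.translation_ne_zero r₁) e₁
  obtain ⟨k₂, l₂, u₂, hk₂, hl₂, t₂, m₂⟩ :=
    Deformation.exists_of_eqUpToScale h₂ (Deformation.translation_ne_zero r₂) e₂
  obtain ⟨k₃, l₃, u₃, hk₃, hl₃, t₃, m₃⟩ :=
    Deformation.exists_of_eqUpToScale h₃ (Deformation.translation_ne_zero r₃) e₃
  obtain ⟨t, ht⟩ := IsAlgClosed.exists_pow_nat_eq (k₁ * k₂ ^ 2 * l₁ / (l₃ * k₃)) two_pos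
  have ht0 : t ≠ 0 := by
    rintro rfl
    have : k₁ * k₂ ^ 2 * l₁ / (l₃ * k₃) ≠ 0 := by positivity
    exact this (by rw [← ht]; simp)
  rw [eq_div_iff (mul_ne_zero hl₃ hk₃)] at ht
  refine ⟨⟨k₁, k₂, k₃, l₁, l₂, l₃, t * l₂ / l₃, t ^ 2 * l₂ / (k₂ * l₁), t, u₁, u₂, u₃,
    hk₁, hk₂, hk₃, hl₁, hl₂, hl₃, by positivity, by positivity, ht0, t₁, t₂, t₃, m₁, m₂, m₃,
    ?_, ?_, ?_⟩⟩
  · field_simp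
  · field_simp
  · field_simp
    linear_combination ht

namespace Normalization

variable {D₁ D₂ R₁₂ R₂₃ R₁₃ : Deformation K} (N : Normalization D₁ D₂ R₁₂ R₂₃ R₁₃)
variable {S : Type*} [CommRing S] [Algebra K S]

theorem isSolution_iff {v₁ v₂ v₃ w₁ w₂ w₃ : Fin 3 → S}
    (h₁ : ∀ i, algebraMap K S N.k₁ * w₁ i = algebraMap K S (N.u₁ i) + algebraMap K S N.l₁ * v₁ i)
    (h₂ : ∀ i, algebraMap K S N.k₂ * w₂ i = algebraMap K S (N.u₂ i) + algebraMap K S N.l₂ * v₂ i)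
    (h₃ : ∀ i, algebraMap K S N.k₃ * w₃ i = algebraMap K S (N.u₃ i) + algebraMap K S N.l₃ * v₃ i)
    (α β γ : S) :
    IsSolution (baseChange S R₁₂) (baseChange S R₂₃) (baseChange S R₁₃)
        (algebraMap K S N.s * α) (algebraMap K S N.t * β) (algebraMap K S N.r * γ) v₁ v₂ v₃ ↔
      IsSolution (baseChange S D₁) (baseChange S D₂)
        (compose (baseChange S D₁) (baseChange S D₂)) α β γ w₁ w₂ w₃ := by
  rw [← baseChange_andThen]
  refine isSolution_rescale (translation_baseChange N.translation₁)
    (translation_baseChange N.translation₂) (translation_baseChange N.translation₃)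
    (shear_baseChange N.translation₁ N.linear₁ h₁) (shear_baseChange N.translation₂ N.linear₂ h₂)
    (shear_baseChange N.translation₃ N.linear₃ h₃) ?_ ?_ ?_ ?_ ?_ α β γ
  · simpa using congrArg (algebraMap K S) N.rel_α
  · simpa using congrArg (algebraMap K S) N.rel_γ
  · simpa using congrArg (algebraMap K S) N.rel_αβγ
  · rw [← map_pow, ← map_mul]
    exact (isUnit_iff_ne_zero.mpr (mul_ne_zero (pow_ne_zero 2 N.t_ne) N.l₂_ne)).map _
  · rw [← map_mul, ← map_mul]
    exact (isUnit_iff_ne_zero.mpr (mul_ne_zero (mul_ne_zero N.r_ne N.k₁_ne) N.k₂_ne)).map _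

/-- The three parameters of the family of solutions, read off from the unknown `v₁`. -/
noncomputable def parameter (v : Fin 3 → S) : Fin 3 → S :=
  (fun i => algebraMap K S N.k₁⁻¹ * (algebraMap K S (N.u₁ i) + algebraMap K S N.l₁ * v i))
    ᵥ* (D₁.linear⁻¹).map (algebraMap K S)

theorem map_parameter {S' : Type*} [CommRing S'] [Algebra K S'] (φ : S →ₐ[K] S') (v : Fin 3 → S)
    (j : Fin 3) : φ (N.parameter v j) = N.parameter (fun i => φ (v i)) j := by
  simp [parameter, vecMul, dotProduct, map_sum]

theorem algebraMap_inv_mul_cancel {c : K} (hc : c ≠ 0) :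
    algebraMap K S c⁻¹ * algebraMap K S c = 1 := by
  rw [← map_mul, inv_mul_cancel₀ hc, map_one]

theorem map_inv_mul_map {A : Matrix (Fin 3) (Fin 3) K} (hA : IsUnit A.det) :
    (A⁻¹).map (algebraMap K S) * A.map (algebraMap K S) = 1 ∧
      A.map (algebraMap K S) * (A⁻¹).map (algebraMap K S) = 1 := by
  constructor
  · rw [← Matrix.map_mul, nonsing_inv_mul _ hA, Matrix.map_one _ (map_zero _) (map_one _)]
  · rw [← Matrix.map_mul, mul_nonsing_inv _ hA, Matrix.map_one _ (map_zero _) (map_one _)]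

theorem parameter_vecMul (h₁ : D₁.Invertible) (v : Fin 3 → S) (i : Fin 3) :
    algebraMap K S N.k₁ * (N.parameter v ᵥ* (baseChange S D₁).linear) i
      = algebraMap K S (N.u₁ i) + algebraMap K S N.l₁ * v i := by
  simp only [parameter, baseChange]
  rw [vecMul_vecMul, (map_inv_mul_map (isUnit_iff_ne_zero.mpr h₁)).1, vecMul_one]
  linear_combination (algebraMap K S (N.u₁ i) + algebraMap K S N.l₁ * v i)
    * algebraMap_inv_mul_cancel (S := S) N.k₁_ne

theorem parameter_eq (h₁ : D₁.Invertible) {v U : Fin 3 → S}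
    (h : ∀ i, algebraMap K S N.k₁ * (U ᵥ* (baseChange S D₁).linear) i
      = algebraMap K S (N.u₁ i) + algebraMap K S N.l₁ * v i) : N.parameter v = U := by
  have : (fun i => algebraMap K S N.k₁⁻¹ * (algebraMap K S (N.u₁ i) + algebraMap K S N.l₁ * v i))
      = U ᵥ* (baseChange S D₁).linear := by
    ext i
    rw [← h, ← mul_assoc, algebraMap_inv_mul_cancel N.k₁_ne, one_mul]
  rw [parameter, this]
  simp only [baseChange]
  rw [vecMul_vecMul, (map_inv_mul_map (isUnit_iff_ne_zero.mpr h₁)).2, vecMul_one]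

end Normalization

/-- The polynomial `1 + u · a` in the parameters `u`. -/
noncomputable def scalePolynomial (a : Fin 3 → K) : MvPolynomial (Fin 3) K :=
  1 + MvPolynomial.X ⬝ᵥ fun i => MvPolynomial.C (a i)

theorem constantCoeff_scalePolynomial (a : Fin 3 → K) :
    MvPolynomial.constantCoeff (scalePolynomial a) = 1 := by
  simp [scalePolynomial, dotProduct]

theorem map_scalePolynomial {S : Type*} [CommRing S] [Algebra K S]
    (φ : MvPolynomial (Fin 3) K →ₐ[K] S) (D : Deformation K) :
    φ (scalePolynomial D.translation)
      = 1 + (fun i => φ (MvPolynomial.X i)) ⬝ᵥ (baseChange S D).translation := by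
  have hC (c : K) : φ (MvPolynomial.C c) = algebraMap K S c := φ.commutes c
  simp only [scalePolynomial, dotProduct, map_add, map_one, map_sum, map_mul, hC, baseChange]

-- The family over `L`, the localization of `K[u]` at `f`, gives a map `φ` from the coordinate ring
-- to `L`; the parameters read off from `v₁` give `i` from `K[u]` to the coordinate ring. Their
-- composite is the localization map, and `f` equals 1 at the origin.
open MvPolynomial in
theorem Normalization.three_le_dimX {D₁ D₂ R₁₂ R₂₃ R₁₃ : Deformation K}
    (N : Normalization D₁ D₂ R₁₂ R₂₃ R₁₃) (h₁ : D₁.Invertible) :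
    3 ≤ dimX R₁₂ R₂₃ R₁₃ := by
  let f := scalePolynomial D₁.translation
  let L := Localization.Away f
  let ι : MvPolynomial (Fin 3) K →ₐ[K] L := IsScalarTower.toAlgHom K _ L
  let c : K → L := algebraMap K L
  let z' : L := IsLocalization.Away.invSelf f
  let U : Fin 3 → L := fun i => ι (X i)
  have hz : ι f * z' = 1 := IsLocalization.Away.mul_invSelf f
  have hf : ι f = 1 + U ⬝ᵥ (baseChange L D₁).translation := map_scalePolynomial ι D₁
  let w : Fin 3 → L := U ᵥ* (baseChange L D₁).linear
  -- The solution `v` of `k w = u + l v`: it returns from normalized to original unknowns.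
  let shift (k l : K) (u : Fin 3 → K) (w : Fin 3 → L) (i : Fin 3) : L :=
    c l⁻¹ * (c k * w i - c (u i))
  have hshift {k l : K} (hl : l ≠ 0) (u : Fin 3 → K) (w : Fin 3 → L) (i : Fin 3) :
      c k * w i = c (u i) + c l * shift k l u w i := by
    have := Normalization.algebraMap_inv_mul_cancel (S := L) hl
    simp only [shift, c]
    linear_combination (algebraMap K L (u i) - algebraMap K L k * w i) * this
  let g : Unknown → L
    | .α => c N.s * ι f
    | .β => c N.t * 1
    | .γ => c N.r * ι f
    | .x => c N.s⁻¹ * z'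
    | .y => c N.t⁻¹
    | .z => c N.r⁻¹ * z'
    | .v₁ i => shift N.k₁ N.l₁ N.u₁ w i
    | .v₂ i => shift N.k₂ N.l₂ N.u₂ (z' • U) i
    | .v₃ i => shift N.k₃ N.l₃ N.u₃ w i
  have hker : systemIdeal R₁₂ R₂₃ R₁₃ ≤ RingHom.ker (aeval (R := K) g) := by
    rw [systemIdeal_le_ker_iff]
    simp only [aeval_X]
    refine ⟨?_, ?_, ?_, ?_⟩
    · refine (N.isSolution_iff (w₁ := w) (w₂ := z' • U) (w₃ := w) (hshift N.l₁_ne N.u₁ w)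
        (hshift N.l₂_ne N.u₂ _) (hshift N.l₃_ne N.u₃ w) _ _ _).mpr ?_
      exact isSolution_compose _ _ U hf hz
    · have := Normalization.algebraMap_inv_mul_cancel (S := L) N.s_ne
      simp only [g, c]
      linear_combination ι f * z' * this + hz
    · have := Normalization.algebraMap_inv_mul_cancel (S := L) N.t_ne
      simp only [g, c]
      linear_combination this
    · have := Normalization.algebraMap_inv_mul_cancel (S := L) N.r_ne
      simp only [g, c]
      linear_combination ι f * z' * this + hz
  let T := PolyRing K ⧸ systemIdeal R₁₂ R₂₃ R₁₃
  let π : PolyRing K →ₐ[K] T := Ideal.Quotient.mkₐ K _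
  let φ : T →ₐ[K] L := Ideal.Quotient.liftₐ _ (aeval g) hker
  have hφ (p : PolyRing K) : φ (π p) = aeval g p := Ideal.Quotient.liftₐ_apply _ _ _ _
  let i : MvPolynomial (Fin 3) K →ₐ[K] T :=
    aeval (N.parameter fun j => π (X (Unknown.v₁ j)))
  have hcomp : φ.comp i = ι := by
    ext1 j
    rw [AlgHom.comp_apply, aeval_X, N.map_parameter]
    simp only [hφ, aeval_X]
    exact congrFun (N.parameter_eq h₁ (hshift N.l₁_ne N.u₁ w)) j
  have := le_ringKrullDim_of_comp_eq_algebraMap (f := f) (T := T)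
    (by rw [constantCoeff_scalePolynomial]; exact one_ne_zero) i.toRingHom φ.toRingHom
    (congrArg AlgHom.toRingHom hcomp)
  exact this

end Normalization

end AffineSfM

namespace AffineSfM

/-! ### The upper bound when `B a` and `b` are independent -/

section UpperBound

variable {K : Type*} [Field K]

/-- Cramer's rule in the last two coordinates gives `p` and `q`; `r` is the cross product `m × b`,
with first entry `d`. -/
theorem exists_dual_vectors {m b : Fin 3 → K} (hd : m 1 * b 2 - m 2 * b 1 ≠ 0) :
    ∃ p q r : Fin 3 → K, p ⬝ᵥ m = 1 ∧ p ⬝ᵥ b = 0 ∧ q ⬝ᵥ m = 0 ∧ q ⬝ᵥ b = 1 ∧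
      r ⬝ᵥ m = 0 ∧ r ⬝ᵥ b = 0 ∧ r ≠ 0 := by
  set d := m 1 * b 2 - m 2 * b 1 with hdef
  refine ⟨d⁻¹ • ![0, b 2, -b 1], d⁻¹ • ![0, -m 2, m 1],
    ![d, m 2 * b 0 - m 0 * b 2, m 0 * b 1 - m 1 * b 0], ?_, ?_, ?_, ?_, ?_, ?_, ?_⟩
  · simp [dotProduct, Fin.sum_univ_three]
    field_simp
    rw [hdef]; ring
  · simp [dotProduct, Fin.sum_univ_three]
    ring
  · simp [dotProduct, Fin.sum_univ_three]
    ring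
  · simp [dotProduct, Fin.sum_univ_three]
    field_simp
    rw [hdef]; ring
  · simp [dotProduct, Fin.sum_univ_three]
    rw [hdef]; ring
  · simp [dotProduct, Fin.sum_univ_three]
    rw [hdef]; ring
  · exact fun h => hd (congrFun h 0)

theorem baseChange_dotProduct_mulVec {S : Type*} [CommRing S] [Algebra K S]
    (D₁ D₂ : Deformation K) (p : Fin 3 → K) :
    (fun i => algebraMap K S (p i)) ⬝ᵥ
        ((baseChange S D₂).linear *ᵥ (baseChange S D₁).translation)
      = algebraMap K S (p ⬝ᵥ (D₂.linear *ᵥ D₁.translation)) := by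
  simp [baseChange, dotProduct, mulVec, map_sum]

theorem baseChange_dotProduct {S : Type*} [CommRing S] [Algebra K S]
    (D : Deformation K) (p : Fin 3 → K) :
    (fun i => algebraMap K S (p i)) ⬝ᵥ (baseChange S D).translation
      = algebraMap K S (p ⬝ᵥ D.translation) := by
  simp [baseChange, dotProduct, map_sum]

-- All 15 coordinate functions are integral over `K[u]` localized at `f`: `β` because `β² = 1` after
-- normalization, the others because they are polynomials in `β`, `u` and `1 / f`.
open MvPolynomial in
theorem Normalization.dimX_le_three {D₁ D₂ R₁₂ R₂₃ R₁₃ : Deformation K}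
    (N : Normalization D₁ D₂ R₁₂ R₂₃ R₁₃) (h₁ : D₁.Invertible) (h₂ : D₂.Invertible)
    (hd : (D₂.linear *ᵥ D₁.translation) 1 * D₂.translation 2
      - (D₂.linear *ᵥ D₁.translation) 2 * D₂.translation 1 ≠ 0) :
    dimX R₁₂ R₂₃ R₁₃ ≤ 3 := by
  obtain ⟨p, q, r, hpa, hpb, hqa, hqb, hra, hrb, hr⟩ := exists_dual_vectors hd
  have hrBA : r ᵥ* (D₂.linear * D₁.linear) ≠ 0 := by
    intro h0
    have hu : IsUnit (D₂.linear * D₁.linear).det := by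
      rw [det_mul]
      exact isUnit_iff_ne_zero.mpr (mul_ne_zero h₂ h₁)
    have := congrArg (fun w => w ᵥ* (D₂.linear * D₁.linear)⁻¹) h0
    simp only [vecMul_vecMul, mul_nonsing_inv _ hu, vecMul_one, zero_vecMul] at this
    exact hr this
  obtain ⟨j, hj⟩ := Function.ne_iff.mp hrBA
  let T := PolyRing K ⧸ systemIdeal R₁₂ R₂₃ R₁₃
  let π : PolyRing K →ₐ[K] T := Ideal.Quotient.mkₐ K _
  let c : K → T := algebraMap K T
  have hc {a : K} (ha : a ≠ 0) : c a⁻¹ * c a = 1 := algebraMap_inv_mul_cancel ha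
  obtain ⟨hsol, hx, hy, hz⟩ := (systemIdeal_le_ker_iff π R₁₂ R₂₃ R₁₃).mp
    (Ideal.Quotient.mkₐ_ker K _).ge
  set v₁ : Fin 3 → T := fun i => π (X (Unknown.v₁ i)) with hv₁
  set v₂ : Fin 3 → T := fun i => π (X (Unknown.v₂ i)) with hv₂
  set v₃ : Fin 3 → T := fun i => π (X (Unknown.v₃ i)) with hv₃
  set α := c N.s⁻¹ * π (X Unknown.α) with hα
  set β := c N.t⁻¹ * π (X Unknown.β) with hβ
  set γ := c N.r⁻¹ * π (X Unknown.γ) with hγ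
  have hα' : π (X Unknown.α) = c N.s * α := by
    linear_combination (-π (X Unknown.α)) * hc N.s_ne + c N.s * hα
  have hβ' : π (X Unknown.β) = c N.t * β := by
    linear_combination (-π (X Unknown.β)) * hc N.t_ne + c N.t * hβ
  have hγ' : π (X Unknown.γ) = c N.r * γ := by
    linear_combination (-π (X Unknown.γ)) * hc N.r_ne + c N.r * hγ
  let U : Fin 3 → T := N.parameter v₁
  let w₁ : Fin 3 → T := U ᵥ* (baseChange T D₁).linear
  let w₂ : Fin 3 → T := fun i => c N.k₂⁻¹ * (c (N.u₂ i) + c N.l₂ * v₂ i)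
  let w₃ : Fin 3 → T := fun i => c N.k₃⁻¹ * (c (N.u₃ i) + c N.l₃ * v₃ i)
  have hw₁ (i) : c N.k₁ * w₁ i = c (N.u₁ i) + c N.l₁ * v₁ i := N.parameter_vecMul h₁ v₁ i
  have hw₂ (i) : c N.k₂ * w₂ i = c (N.u₂ i) + c N.l₂ * v₂ i := by
    linear_combination (c (N.u₂ i) + c N.l₂ * v₂ i) * hc N.k₂_ne
  have hw₃ (i) : c N.k₃ * w₃ i = c (N.u₃ i) + c N.l₃ * v₃ i := by
    linear_combination (c (N.u₃ i) + c N.l₃ * v₃ i) * hc N.k₃_ne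
  have hunit {a : K} (ha : a ≠ 0) : IsUnit (c a) := (isUnit_iff_ne_zero.mpr ha).map _
  have hαu : IsUnit α :=
    (hunit (inv_ne_zero N.s_ne)).mul (IsUnit.of_mul_eq_one _ hx)
  have hβu : IsUnit β :=
    (hunit (inv_ne_zero N.t_ne)).mul (IsUnit.of_mul_eq_one _ hy)
  have hγu : IsUnit γ :=
    (hunit (inv_ne_zero N.r_ne)).mul (IsUnit.of_mul_eq_one _ hz)
  rw [hα', hβ', hγ'] at hsol
  have hsol' := (N.isSolution_iff hw₁ hw₂ hw₃ α β γ).mp hsol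
  obtain ⟨hββ, hαβγ, h31, hwU, hγU⟩ := hsol'.eq_of_dual hαu hβu hγu
    (p := fun i => c (p i)) (q := fun i => c (q i)) (r := fun i => c (r i))
    (by rw [baseChange_dotProduct_mulVec, hpa, map_one])
    (by rw [baseChange_dotProduct, hpb, map_zero])
    (by rw [baseChange_dotProduct_mulVec, hqa, map_zero])
    (by rw [baseChange_dotProduct, hqb, map_one])
    (by rw [baseChange_dotProduct_mulVec, hra, map_zero])
    (by rw [baseChange_dotProduct, hrb, map_zero])
    (j := j) (by
      have : ((fun i => c (r i)) ᵥ* ((baseChange T D₂).linear * (baseChange T D₁).linear)) j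
          = c ((r ᵥ* (D₂.linear * D₁.linear)) j) := by
        simp [c, baseChange, vecMul, dotProduct, Matrix.mul_apply, map_sum]
      rw [this]
      exact hunit hj)
    (u := U) rfl (by
      have : (baseChange T D₁).linear.det = c D₁.linear.det :=
        ((algebraMap K T).map_det D₁.linear).symm
      rw [this]
      exact hunit h₁)
  let f := scalePolynomial D₁.translation
  let i : MvPolynomial (Fin 3) K →ₐ[K] T := aeval U
  have hif : i f = 1 + U ⬝ᵥ (baseChange T D₁).translation := by
    rw [map_scalePolynomial]
    simp only [i, aeval_X]
  -- `γ = β f` is a unit, hence `f` becomes invertible and `i` extends to the localization.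
  have hifu : IsUnit (i.toRingHom f) := by
    change IsUnit (i f)
    rw [hif]
    rw [hγU] at hγu
    exact isUnit_of_mul_isUnit_right hγu
  let g : Localization.Away f →+* T := IsLocalization.Away.lift f hifu
  have hgi (a) : g (algebraMap _ _ a) = i a := IsLocalization.Away.lift_eq f hifu a
  let e : T := g (IsLocalization.Away.invSelf f)
  have he : i f * e = 1 := by
    rw [← hgi, ← map_mul, IsLocalization.Away.mul_invSelf, map_one]
  have hγe : γ * (β * e) = 1 := by
    rw [hγU, ← hif]
    linear_combination β ^ 2 * he + hββ
  have Hi (a) : g.IsIntegralElem (i a) := by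
    rw [← hgi]
    exact g.isIntegralElem_map
  have Hc (a : K) : g.IsIntegralElem (c a) := by
    have := Hi (C a)
    rwa [show i (C a) = c a from i.commutes a] at this
  have HU (k) : g.IsIntegralElem (U k) := by
    have := Hi (X k)
    rwa [show i (X k) = U k from aeval_X _ _] at this
  have He : g.IsIntegralElem e := g.isIntegralElem_map
  have Hβ : g.IsIntegralElem β := by
    refine ⟨Polynomial.X ^ 2 - Polynomial.C 1, Polynomial.monic_X_pow_sub_C 1 two_ne_zero, ?_⟩
    simp [hββ]
  have Hγ : g.IsIntegralElem γ := by
    rw [hγU, ← hif]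
    exact Hβ.mul _ (Hi f)
  have Hα : g.IsIntegralElem α := by
    rw [hαβγ]
    exact Hβ.mul _ Hγ
  have Hw₁ (k) : g.IsIntegralElem (w₁ k) := by
    simp only [w₁, vecMul, dotProduct, Fin.sum_univ_three]
    exact (((HU 0).mul _ (Hc _)).add _ ((HU 1).mul _ (Hc _))).add _ ((HU 2).mul _ (Hc _))
  have Hw₂ (k) : g.IsIntegralElem (w₂ k) := by
    have h := congrFun hwU k
    simp only [Pi.smul_apply, smul_eq_mul] at h
    have : w₂ k = e * U k := by
      linear_combination (-w₂ k) * hγe + β * e * h + e * U k * hββ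
    rw [this]
    exact He.mul _ (HU k)
  have Hw₃ (k) : g.IsIntegralElem (w₃ k) := by
    rw [h31]
    exact Hw₁ k
  have Hshift {a l : K} (hl : l ≠ 0) {u : Fin 3 → K} {w v : Fin 3 → T}
      (Hw : ∀ k, g.IsIntegralElem (w k)) (h : ∀ k, c a * w k = c (u k) + c l * v k) (k) :
      g.IsIntegralElem (v k) := by
    have : v k = c l⁻¹ * (c a * w k - c (u k)) := by
      linear_combination (-v k) * hc hl - c l⁻¹ * h k
    rw [this]
    exact (Hc _).mul _ (((Hc _).mul _ (Hw k)).sub _ (Hc _))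
  have HX (k : Unknown) : g.IsIntegralElem (π (X k)) := by
    cases k with
    | α => rw [hα']; exact (Hc _).mul _ Hα
    | β => rw [hβ']; exact (Hc _).mul _ Hβ
    | γ => rw [hγ']; exact (Hc _).mul _ Hγ
    | x =>
      have : π (X Unknown.x) = c N.s⁻¹ * e := by
        refine (left_inv_eq_right_inv ?_ hx).symm
        rw [hα', hαβγ]
        linear_combination c N.s⁻¹ * c N.s * hγe + hc N.s_ne
      rw [this]
      exact (Hc _).mul _ He
    | y =>
      have : π (X Unknown.y) = c N.t⁻¹ * β := by
        refine (left_inv_eq_right_inv ?_ hy).symm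
        rw [hβ']
        linear_combination c N.t⁻¹ * c N.t * hββ + hc N.t_ne
      rw [this]
      exact (Hc _).mul _ Hβ
    | z =>
      have : π (X Unknown.z) = c N.r⁻¹ * (β * e) := by
        refine (left_inv_eq_right_inv ?_ hz).symm
        rw [hγ']
        linear_combination c N.r⁻¹ * c N.r * hγe + hc N.r_ne
      rw [this]
      exact (Hc _).mul _ (Hβ.mul _ He)
    | v₁ k => exact Hshift N.l₁_ne Hw₁ hw₁ k
    | v₂ k => exact Hshift N.l₂_ne Hw₂ hw₂ k
    | v₃ k => exact Hshift N.l₃_ne Hw₃ hw₃ k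
  have hg : g.IsIntegral := by
    intro y
    obtain ⟨a, rfl⟩ := Ideal.Quotient.mkₐ_surjective K _ y
    change g.IsIntegralElem (π a)
    induction a using MvPolynomial.induction_on with
    | C a => rw [map_C_eq_algebraMap]; exact Hc a
    | add a b ha hb => rw [map_add]; exact ha.add _ hb
    | mul_X a k ha => rw [map_mul]; exact ha.mul _ (HX k)
  refine (ringKrullDim_le_of_isIntegral_away g hg).trans ?_
  rw [MvPolynomial.ringKrullDim_of_isNoetherianRing, ringKrullDim_eq_zero_of_field]
  simp

end UpperBound

/-! ### The genericity condition -/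

section Generic

open MvPolynomial Deformation

/-- The deformation whose entries are the coordinates indexed by `i`. -/
noncomputable def genericDeformation (i : Coord → Coord ⊕ Coord) :
    Deformation (MvPolynomial (Coord ⊕ Coord) ℝ) :=
  ⟨Matrix.of fun j k => X (i (Sum.inl (j, k))), fun j => X (i (Sum.inr j))⟩

/-- The polynomial `det A * det B * (B a × b)₀`. -/
noncomputable def genericityPolynomial : MvPolynomial (Coord ⊕ Coord) ℝ :=
  (genericDeformation Sum.inl).linear.det * (genericDeformation Sum.inr).linear.det *
    (((genericDeformation Sum.inr).linear *ᵥ (genericDeformation Sum.inl).translation) 1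
        * (genericDeformation Sum.inr).translation 2
      - ((genericDeformation Sum.inr).linear *ᵥ (genericDeformation Sum.inl).translation) 2
        * (genericDeformation Sum.inr).translation 1)

theorem aeval_genericityPolynomial {K : Type*} [Field K] [Algebra ℝ K] (D₁ D₂ : Deformation K) :
    aeval (Sum.elim D₁.coord D₂.coord) genericityPolynomial
      = D₁.linear.det * D₂.linear.det *
        ((D₂.linear *ᵥ D₁.translation) 1 * D₂.translation 2
          - (D₂.linear *ᵥ D₁.translation) 2 * D₂.translation 1) := by
  simp [genericityPolynomial, genericDeformation, Deformation.coord, det_fin_three, mulVec,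
    dotProduct, Fin.sum_univ_three]

theorem genericityPolynomial_ne_zero : genericityPolynomial ≠ 0 := by
  intro h
  -- Two identity matrices with the second and third basis vectors as translations: the polynomial
  -- takes the value 1.
  have := aeval_genericityPolynomial (K := ℝ) ⟨1, ![0, 1, 0]⟩ ⟨1, ![0, 0, 1]⟩
  rw [h] at this
  simp at this

/-- A nonzero coordinate of `B a × b` forces `a`, `b` and `B a + b` to be nonzero, since `B a = -b`
would make the product vanish. -/
theorem admissible_of_generic {K : Type*} [Field K] {D₁ D₂ : Deformation K} (h₁ : D₁.Invertible)
    (h₂ : D₂.Invertible)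
    (hd : (D₂.linear *ᵥ D₁.translation) 1 * D₂.translation 2
      - (D₂.linear *ᵥ D₁.translation) 2 * D₂.translation 1 ≠ 0) :
    Admissible D₁ D₂ := by
  refine ⟨h₁, h₂, Deformation.rank_essential h₁ ?_, Deformation.rank_essential h₂ ?_,
    Deformation.rank_essential ?_ ?_⟩
  · intro h0
    simp [h0] at hd
  · intro h0
    simp [h0] at hd
  · change (D₂.linear * D₁.linear).det ≠ 0
    rw [det_mul]
    exact mul_ne_zero h₂ h₁
  · intro h0
    have e₁ := congrFun h0 1
    have e₂ := congrFun h0 2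
    simp only [Deformation.andThen, Pi.add_apply, Pi.zero_apply] at e₁ e₂
    apply hd
    linear_combination D₂.translation 2 * e₁ - D₂.translation 1 * e₂

end Generic

end AffineSfM

open AffineSfM in
theorem mainTheorem2 :
    -- the dimension is always at least 3
    (∀ D₁ D₂ : Deformation ℂ, Admissible D₁ D₂ →
      ∀ R₁₂ R₂₃ R₁₃ : Deformation ℂ, Decomposes D₁ D₂ R₁₂ R₂₃ R₁₃ →
        3 ≤ dimX R₁₂ R₂₃ R₁₃) ∧
    -- it is exactly 3 on a nonempty Zariski open set of pairs of deformations, defined over the reals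
    (∃ P : MvPolynomial (Deformation.Coord ⊕ Deformation.Coord) ℝ, P ≠ 0 ∧
      ∀ D₁ D₂ : Deformation ℂ,
        MvPolynomial.aeval (Sum.elim D₁.coord D₂.coord) P ≠ 0 →
          Admissible D₁ D₂ ∧
          ∀ R₁₂ R₂₃ R₁₃ : Deformation ℂ, Decomposes D₁ D₂ R₁₂ R₂₃ R₁₃ →
            dimX R₁₂ R₂₃ R₁₃ = 3) ∧
    -- real deformations are not determined by the essential matrices
    (∀ D₁ D₂ : Deformation ℝ, Admissible D₁ D₂ → (indistinguishable D₁ D₂).Infinite) := by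
  refine ⟨fun D₁ D₂ h R₁₂ R₂₃ R₁₃ hR => ?_,
    ⟨genericityPolynomial, genericityPolynomial_ne_zero, fun D₁ D₂ h => ?_⟩,
    fun D₁ D₂ h => infinite_indistinguishable h⟩
  · obtain ⟨N⟩ := nonempty_normalization h hR
    exact N.three_le_dimX h.1
  · rw [aeval_genericityPolynomial] at h
    obtain ⟨⟨h₁, h₂⟩, hd⟩ := (mul_ne_zero_iff.mp h).imp_left mul_ne_zero_iff.mp
    have hadm := admissible_of_generic h₁ h₂ hd
    refine ⟨hadm, fun R₁₂ R₂₃ R₁₃ hR => ?_⟩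
    obtain ⟨N⟩ := nonempty_normalization hadm hR
    exact le_antisymm (N.dimX_le_three h₁ h₂ hd) (N.three_le_dimX h₁)
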